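/- An $(a,b)$-module is a free $\mathbb{C}[[b]]$-module $E$ of finite rank endowed with a $\mathbb{C}$-linear endomorphism $a$ such that $a\,S = S\,a + b^2 S'$ for every $S\in\mathbb{C}[[b]]$. Morphisms are the $\mathbb{C}[[b]]$-linear maps commuting with $a$; sub-modules are the $\mathbb{C}[[b]]$-submodules stable by $a$. $E$ has a simple pole if $aE\subset bE$, and $E$ is regular if it embeds in an $(a,b)$-module with a simple pole. The dual of $E$ is $E^*=\mathrm{Hom}_{\mathbb{C}[[b]]}(E,E_0)$, where $E_0=\mathbb{C}[[b]]\,e_0$ with $a e_0=0$, with $(b\varphi)(x)=b\,\varphi(x)$ and $(a\varphi)(x)=a\,\varphi(x)-\varphi(a x)$. $E$ is semi-simple if it is isomorphic to a sub-module of a finite direct sum of regular $(a,b)$-modules of rank $1$. An element $x\in E$ is semi-simple if the sub-module of $E$ generated by $x$ is semi-simple. The semi-simple part $S_1(E)$ of a regular $(a,b)$-module $E$ is the sub-module of its semi-simple elements. The semi-simple filtration of $E$ is defined by $S_0(E)=\{0\}$ and by taking $S_j(E)$, for $j\ge 1$, to be the pull-back to $E$ of the semi-simple part of $E/S_{j-1}(E)$.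 The semi-simple depth $d(E)$ is the smallest integer $d\ge 0$ such that $S_d(E)=E$. Statement: for any regular $(a,b)$-module $E$, the dual $E^*$ is a regular $(a,b)$-module, the semi-simple depths $d(E)$ and $d(E^*)$ are well defined (that is, $S_j(E)=E$ for some $j$ and $S_j(E^*)=E^*$ for some $j$), and $$ d(E^*) = d(E). $$ -/

import Mathlib

open scoped PowerSeries

universe u v

/-- A module over `ℂ[[b]]` (the variable `X` of the power series ring is `b`) together with an
additive operator `a` satisfying `a.S = S.a + b².S'` for every `S ∈ ℂ[[b]]`.
Taking `S` constant shows that `a` is `ℂ`-linear. -/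
class ABAction (E : Type u) [AddCommGroup E] [Module ℂ⟦X⟧ E] where
  /-- the operator `a` -/
  a : E →+ E
  a_smul : ∀ (S : ℂ⟦X⟧) (x : E),
    a (S • x) = S • a x + (PowerSeries.X ^ 2 * PowerSeries.derivative ℂ S) • x

namespace ABAction

/-- An (a,b)-module: free of finite rank over `ℂ[[b]]`. -/
structure IsABModule (E : Type u) [AddCommGroup E] [Module ℂ⟦X⟧ E] [ABAction E] : Prop where
  free : Module.Free ℂ⟦X⟧ E
  finite : Module.Finite ℂ⟦X⟧ E

/-- `E` has a simple pole: `a.E ⊂ b.E`. -/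
def HasSimplePole (E : Type u) [AddCommGroup E] [Module ℂ⟦X⟧ E] [ABAction E] : Prop :=
  ∀ x : E, ∃ y : E, a x = (PowerSeries.X : ℂ⟦X⟧) • y

/-- A morphism: a `ℂ[[b]]`-linear map commuting with `a`. -/
structure Hom (E : Type u) (F : Type v) [AddCommGroup E] [Module ℂ⟦X⟧ E] [ABAction E]
    [AddCommGroup F] [Module ℂ⟦X⟧ F] [ABAction F] extends E →ₗ[ℂ⟦X⟧] F where
  map_a : ∀ x : E, toLinearMap (a x) = a (toLinearMap x)

/-- `E` embeds in `F`, i.e. it is isomorphic to a sub-module of `F`. -/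
def Embeds (E : Type u) (F : Type v) [AddCommGroup E] [Module ℂ⟦X⟧ E] [ABAction E]
    [AddCommGroup F] [Module ℂ⟦X⟧ F] [ABAction F] : Prop :=
  ∃ f : Hom E F, Function.Injective f.toLinearMap

/-- A regular (a,b)-module: one that embeds in a simple pole (a,b)-module. -/
def IsRegular (E : Type u) [AddCommGroup E] [Module ℂ⟦X⟧ E] [ABAction E] : Prop :=
  IsABModule E ∧
    ∃ (F : Type u) (_ : AddCommGroup F) (_ : Module ℂ⟦X⟧ F) (_ : ABAction F),
      IsABModule F ∧ HasSimplePole F ∧ Embeds E F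

/-- The operator `a` on a finite direct sum acts on each summand. -/
noncomputable instance instPi {n : ℕ} (L : Fin n → Type u) [∀ i, AddCommGroup (L i)]
    [∀ i, Module ℂ⟦X⟧ (L i)] [∀ i, ABAction (L i)] : ABAction (∀ i, L i) where
  a :=
    { toFun := fun x i => a (x i)
      map_zero' := by ext i; simp
      map_add' := by intro x y; ext i; simp }
  a_smul := by intro S x; ext i; simp [a_smul]

/-- `E` is semi-simple: it embeds in a finite direct sum of regular (a,b)-modules of rank 1.
The summands may be taken in the lowest universe, as a rank 1 module is isomorphic to one whose
underlying `ℂ[[b]]`-module is `ℂ[[b]]`. -/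
def IsSemisimple (E : Type u) [AddCommGroup E] [Module ℂ⟦X⟧ E] [ABAction E] : Prop :=
  ∃ (n : ℕ) (L : Fin n → Type) (_ : ∀ i, AddCommGroup (L i)) (_ : ∀ i, Module ℂ⟦X⟧ (L i))
    (_ : ∀ i, ABAction (L i)),
    (∀ i, IsRegular (L i) ∧ Module.finrank ℂ⟦X⟧ (L i) = 1) ∧ Embeds E (∀ i, L i)

section

variable (E : Type u) [AddCommGroup E] [Module ℂ⟦X⟧ E] [ABAction E]

/-- A sub-module: a `ℂ[[b]]`-submodule stable by `a`. -/
structure ABSubmodule extends Submodule ℂ⟦X⟧ E where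
  a_mem : ∀ x ∈ toSubmodule, a x ∈ toSubmodule

end

section

variable {E : Type u} [AddCommGroup E] [Module ℂ⟦X⟧ E] [ABAction E]

/-- The action induced on a sub-module. -/
noncomputable instance instSub (F : ABSubmodule E) : ABAction F.toSubmodule where
  a :=
    { toFun := fun x => ⟨a (x : E), F.a_mem x x.2⟩
      map_zero' := by ext; simp
      map_add' := by intro x y; ext; simp }
  a_smul := by intro S x; ext; simp [a_smul]

/-- The action induced on the quotient by a sub-module. -/
noncomputable instance instQuotient (F : ABSubmodule E) : ABAction (E ⧸ F.toSubmodule) where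
  a := QuotientAddGroup.map F.toSubmodule.toAddSubgroup F.toSubmodule.toAddSubgroup a
    (fun x hx => F.a_mem x hx)
  a_smul := by
    intro S x
    obtain ⟨x, rfl⟩ := Submodule.Quotient.mk_surjective _ x
    exact congrArg (Submodule.Quotient.mk (p := F.toSubmodule)) (a_smul S x)

/-- The sub-module generated by `x`: the smallest `ℂ[[b]]`-submodule
stable by `a` that contains `x`. -/
noncomputable def generated (x : E) : ABSubmodule E where
  toSubmodule := sInf {p : Submodule ℂ⟦X⟧ E | x ∈ p ∧ ∀ y ∈ p, a y ∈ p}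
  a_mem := by
    intro y hy
    rw [Submodule.mem_sInf] at hy ⊢
    exact fun p hp => hp.2 y (hy p hp)

/-- The element `x` is semi-simple: the sub-module it generates is semi-simple. -/
def IsSemisimpleElement (x : E) : Prop :=
  IsSemisimple (generated x).toSubmodule

theorem IsSemisimpleElement.a_mem {x : E} (hx : IsSemisimpleElement x) :
    IsSemisimpleElement (a x) := by
  obtain ⟨n, L, i₁, i₂, i₃, hL, f, hf⟩ := hx
  have hle : (generated (a x)).toSubmodule ≤ (generated x).toSubmodule :=
    sInf_le ⟨(generated x).a_mem x (by
      change x ∈ sInf _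
      rw [Submodule.mem_sInf]
      exact fun p hp => hp.1), (generated x).a_mem⟩
  refine ⟨n, L, i₁, i₂, i₃, hL,
    { toLinearMap := f.toLinearMap ∘ₗ Submodule.inclusion hle
      map_a := fun y => f.map_a (Submodule.inclusion hle y) }, ?_⟩
  exact hf.comp (Submodule.inclusion_injective hle)

variable (E) in
/-- The semi-simple part `S₁(E)`: the sub-module of the semi-simple elements. In a regular
(a,b)-module the semi-simple elements are already a sub-module; taking the span makes the
definition independent of that fact. -/
noncomputable def ssPart : ABSubmodule E where
  toSubmodule := Submodule.span ℂ⟦X⟧ {x : E | IsSemisimpleElement x}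
  a_mem := by
    intro x hx
    induction hx using Submodule.span_induction with
    | mem x h => exact Submodule.subset_span (IsSemisimpleElement.a_mem h)
    | zero => simp
    | add x y _ _ h₁ h₂ => rw [map_add]; exact add_mem h₁ h₂
    | smul S x hx h =>
      rw [a_smul]
      exact add_mem (Submodule.smul_mem _ _ h) (Submodule.smul_mem _ _ hx)

/-- The pull-back to `E` of a sub-module of the quotient `E / F`. -/
noncomputable def ABSubmodule.pullback (F : ABSubmodule E) (G : ABSubmodule (E ⧸ F.toSubmodule)) :
    ABSubmodule E where
  toSubmodule := G.toSubmodule.comap F.toSubmodule.mkQ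
  a_mem := fun x hx => G.a_mem (F.toSubmodule.mkQ x) hx

variable (E) in
/-- The semi-simple filtration: `S₀(E) = 0`, and `Sⱼ₊₁(E)` is the pull-back to `E` of the
semi-simple part of `E / Sⱼ(E)`. -/
noncomputable def ssFiltration : ℕ → ABSubmodule E
  | 0 =>
    { toSubmodule := ⊥
      a_mem := by
        intro x hx
        rw [Submodule.mem_bot] at hx ⊢
        rw [hx, map_zero] }
  | j + 1 => (ssFiltration j).pullback (ssPart (E ⧸ (ssFiltration j).toSubmodule))

variable (E) in
/-- The semi-simple depth `d(E)`: the smallest `d` such that `S_d(E) = E`. -/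
noncomputable def ssDepth : ℕ :=
  sInf {d : ℕ | (ssFiltration E d).toSubmodule = ⊤}

/-- The dual `E* = Hom_{ℂ[[b]]}(E, E₀)`, where `E₀ = ℂ[[b]].e₀` with `a.e₀ = 0`, so that `a` acts
on `E₀` by `S ↦ b².S'`. The action is `(b.φ)(x) = b.φ(x)` and `(a.φ)(x) = a.φ(x) - φ(a.x)`. -/
noncomputable instance instDual : ABAction (Module.Dual ℂ⟦X⟧ E) where
  a :=
    { toFun := fun φ =>
        { toFun := fun x => PowerSeries.X ^ 2 * PowerSeries.derivative ℂ (φ x) - φ (a x)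
          map_add' := by intro x y; simp only [map_add]; ring
          map_smul' := by
            intro S x
            simp only [a_smul, map_add, map_smul, smul_eq_mul, Derivation.leibniz,
              RingHom.id_apply]
            ring }
      map_zero' := by ext1 x; simp
      map_add' := by
        intro φ ψ
        ext1 x
        simp only [LinearMap.coe_mk, AddHom.coe_mk, LinearMap.add_apply, map_add]
        ring }
  a_smul := by
    intro S φ
    ext1 x
    simp only [AddMonoidHom.coe_mk, ZeroHom.coe_mk, LinearMap.coe_mk, AddHom.coe_mk,
      LinearMap.add_apply, LinearMap.smul_apply, smul_eq_mul, Derivation.leibniz]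
    ring

end

end ABAction

namespace ABAction

open Module

/-! The depth equality comes from orthogonality. Suppose `S_n(E) = E` and let `E'` embed in `E*`. By
induction on `j`, the elements of `E'` that vanish on `S_m(E)` lie in `S_j(E')` whenever `j + m =
n`. Indeed, those vanishing on `S_m(E)` map to the dual of `S_{m+1}(E)/S_m(E)`, with kernel those
vanishing on `S_{m+1}(E)`. Hence their image in `E'/S_j(E')` is a quotient of a sub-module of the
dual of a semi-simple module. For `m = 0` this gives `S_n(E') = E'`
(`IsABModule.ssFiltration_eq_top_of_dual`). Taking `E' = E*`, then `E` inside its bidual, gives both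
inequalities.

This needs semi-simplicity to pass to sub-modules, to duals (`IsSemisimple.dual`) and to
torsion-free quotients (`IsABModule.isSemisimple_of_cofinal`). The dual of a map that is onto up to
powers of `b` is injective, so quotients reduce to sub-modules of duals, through the bidual.

Finiteness of the depth follows from noetherianity once a nonzero regular module has a nonzero
semi-simple part. Such a module contains some `x ≠ 0` with `a x = c b x`, found by successive
approximation in a simple pole sub-module. -/

theorem exists_eq_X_pow_mul_unit {S : ℂ⟦X⟧} (hS : S ≠ 0) :
    ∃ (n : ℕ) (w : ℂ⟦X⟧ˣ), S = PowerSeries.X ^ n * (w : ℂ⟦X⟧) := by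
  have hX := (PowerSeries.X_prime (R := ℂ)).irreducible
  obtain ⟨n, w, hw⟩ := IsDiscreteValuationRing.eq_unit_mul_pow_irreducible hS hX
  exact ⟨n, w, by rw [hw, mul_comm]⟩

/-! ### Torsion, freeness and the commutation of `a` with powers of `b`. -/

section Basic

variable {E : Type*} [AddCommGroup E] [Module ℂ⟦X⟧ E]

/-- A nonzero series is a power of `b` times a unit, so `b` is the only scalar to test. -/
theorem isTorsionFree_of_X (h : ∀ x : E, (PowerSeries.X : ℂ⟦X⟧) • x = 0 → x = 0) :
    IsTorsionFree ℂ⟦X⟧ E := by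
  have hpow : ∀ (n : ℕ) (x : E), (PowerSeries.X ^ n : ℂ⟦X⟧) • x = 0 → x = 0 := by
    intro n
    induction n with
    | zero => intro x hx; simpa using hx
    | succ n ih =>
      intro x hx
      rw [pow_succ, mul_smul] at hx
      exact h x (ih _ hx)
  refine ⟨fun S hS x y hxy => ?_⟩
  obtain ⟨n, w, rfl⟩ := exists_eq_X_pow_mul_unit hS.ne_zero
  have h1 : (PowerSeries.X ^ n * (w : ℂ⟦X⟧)) • (x - y) = 0 := by
    rw [smul_sub, sub_eq_zero]; exact hxy
  rw [mul_smul] at h1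
  have h2 := hpow n _ h1
  have h3 : (↑w⁻¹ : ℂ⟦X⟧) • (w : ℂ⟦X⟧) • (x - y) = 0 := by rw [h2, smul_zero]
  rw [smul_smul, Units.inv_mul, one_smul] at h3
  exact sub_eq_zero.mp h3

/-- A linear form vanishing on a set whose elements generate up to powers of `b` vanishes. -/
theorem dual_eq_zero_of_cofinal (N : Submodule ℂ⟦X⟧ E)
    (hN : ∀ x : E, ∃ n : ℕ, (PowerSeries.X ^ n : ℂ⟦X⟧) • x ∈ N) (φ : Dual ℂ⟦X⟧ E)
    (hφ : ∀ x ∈ N, φ x = 0) : φ = 0 := by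
  ext1 x
  obtain ⟨n, hn⟩ := hN x
  have h := hφ _ hn
  rw [map_smul, smul_eq_mul] at h
  simpa using h

variable [ABAction E]

theorem a_X_pow_smul (n : ℕ) (x : E) :
    a ((PowerSeries.X ^ n : ℂ⟦X⟧) • x) =
      (PowerSeries.X ^ n : ℂ⟦X⟧) • (a x + (n : ℂ⟦X⟧) • (PowerSeries.X : ℂ⟦X⟧) • x) := by
  rw [a_smul, smul_add, smul_smul, smul_smul]
  congr 2
  rw [PowerSeries.derivative_pow, PowerSeries.derivative_X]
  cases n with
  | zero => simp
  | succ n => simp only [Nat.add_sub_cancel]; ring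

namespace IsABModule

theorem isTorsionFree (hE : IsABModule E) : IsTorsionFree ℂ⟦X⟧ E := by
  have := hE.free
  infer_instance

theorem smul_left_cancel (hE : IsABModule E) {S : ℂ⟦X⟧} (hS : S ≠ 0) {x y : E}
    (h : S • x = S • y) : x = y := by
  have := hE.isTorsionFree
  exact smul_right_injective E hS h

theorem X_pow_cancel (hE : IsABModule E) {n : ℕ} {x y : E}
    (h : (PowerSeries.X ^ n : ℂ⟦X⟧) • x = (PowerSeries.X ^ n : ℂ⟦X⟧) • y) : x = y :=
  hE.smul_left_cancel (pow_ne_zero n PowerSeries.X_ne_zero) h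

theorem isNoetherian (hE : IsABModule E) : IsNoetherian ℂ⟦X⟧ E := by
  have := hE.finite
  infer_instance

end IsABModule

theorem isABModule_of_X [Module.Finite ℂ⟦X⟧ E]
    (h : ∀ x : E, (PowerSeries.X : ℂ⟦X⟧) • x = 0 → x = 0) : IsABModule E := by
  have := isTorsionFree_of_X h
  exact ⟨inferInstance, inferInstance⟩

theorem IsABModule.of_injective {F : Type*} [AddCommGroup F] [Module ℂ⟦X⟧ F] [ABAction F]
    (hF : IsABModule F) (f : E →ₗ[ℂ⟦X⟧] F) (hf : Function.Injective f) : IsABModule E := by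
  have := hF.isNoetherian
  have : Module.Finite ℂ⟦X⟧ E := Module.Finite.of_injective f hf
  refine isABModule_of_X fun x hx => hf ?_
  refine hF.smul_left_cancel PowerSeries.X_ne_zero ?_
  rw [← map_smul, hx, map_zero, smul_zero]

theorem IsABModule.dual (hE : IsABModule E) : IsABModule (Dual ℂ⟦X⟧ E) := by
  have := hE.free
  have := hE.finite
  exact ⟨inferInstance, inferInstance⟩

theorem IsABModule.sub (hE : IsABModule E) (F : ABSubmodule E) : IsABModule F.toSubmodule :=
  hE.of_injective F.toSubmodule.subtype F.toSubmodule.injective_subtype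

theorem IsABModule.quotient (hE : IsABModule E) (F : ABSubmodule E)
    (h : ∀ x : E, (PowerSeries.X : ℂ⟦X⟧) • x ∈ F.toSubmodule → x ∈ F.toSubmodule) :
    IsABModule (E ⧸ F.toSubmodule) := by
  have := hE.finite
  refine isABModule_of_X fun x hx => ?_
  obtain ⟨x, rfl⟩ := Submodule.Quotient.mk_surjective _ x
  rw [← Submodule.Quotient.mk_smul, Submodule.Quotient.mk_eq_zero] at hx
  exact (Submodule.Quotient.mk_eq_zero _).mpr (h x hx)

end Basic

/-! ### Morphisms, kernels, images, saturation and biduality. -/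

section Homs

variable {E : Type*} [AddCommGroup E] [Module ℂ⟦X⟧ E] [ABAction E]
variable {F : Type*} [AddCommGroup F] [Module ℂ⟦X⟧ F] [ABAction F]
variable {G : Type*} [AddCommGroup G] [Module ℂ⟦X⟧ G] [ABAction G]

/-- The identity morphism. -/
noncomputable def Hom.id (E : Type*) [AddCommGroup E] [Module ℂ⟦X⟧ E] [ABAction E] :
    Hom E E where
  toLinearMap := LinearMap.id
  map_a _ := rfl

/-- Composition of morphisms. -/
noncomputable def Hom.comp (g : Hom F G) (f : Hom E F) : Hom E G where
  toLinearMap := g.toLinearMap ∘ₗ f.toLinearMap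
  map_a x := by simp [f.map_a, g.map_a]

/-- The transpose of a morphism. -/
noncomputable def Hom.dual (f : Hom E F) : Hom (Dual ℂ⟦X⟧ F) (Dual ℂ⟦X⟧ E) where
  toLinearMap := f.toLinearMap.dualMap
  map_a φ := by
    ext x
    simp [a, f.map_a]

theorem dual_a_apply (φ : Dual ℂ⟦X⟧ E) (x : E) :
    a φ x = PowerSeries.X ^ 2 * PowerSeries.derivative ℂ (φ x) - φ (a x) := rfl

/-- The evaluation morphism into the bidual. -/
noncomputable def evalHom (E : Type*) [AddCommGroup E] [Module ℂ⟦X⟧ E] [ABAction E] :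
    Hom E (Dual ℂ⟦X⟧ (Dual ℂ⟦X⟧ E)) where
  toLinearMap := Dual.eval ℂ⟦X⟧ E
  map_a x := by
    ext φ
    simp [dual_a_apply]

/-- The inclusion of a sub-module. -/
noncomputable def ABSubmodule.subtypeHom (P : ABSubmodule E) : Hom P.toSubmodule E where
  toLinearMap := P.toSubmodule.subtype
  map_a _ := rfl

/-- The inclusion between two sub-modules. -/
noncomputable def ABSubmodule.inclusionHom {P Q : ABSubmodule E} (h : P.toSubmodule ≤ Q.toSubmodule) :
    Hom P.toSubmodule Q.toSubmodule where
  toLinearMap := Submodule.inclusion h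
  map_a _ := rfl

/-- The projection to a quotient. -/
noncomputable def ABSubmodule.mkQHom (P : ABSubmodule E) : Hom E (E ⧸ P.toSubmodule) where
  toLinearMap := P.toSubmodule.mkQ
  map_a _ := rfl

/-- The image of a sub-module under a morphism. -/
noncomputable def ABSubmodule.map (P : ABSubmodule E) (f : Hom E F) : ABSubmodule F where
  toSubmodule := P.toSubmodule.map f.toLinearMap
  a_mem := by
    rintro _ ⟨x, hx, rfl⟩
    exact ⟨a x, P.a_mem x hx, f.map_a x⟩

/-- The image of a morphism. -/
noncomputable def Hom.range (f : Hom E F) : ABSubmodule F where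
  toSubmodule := LinearMap.range f.toLinearMap
  a_mem := by
    rintro _ ⟨x, rfl⟩
    exact ⟨a x, f.map_a x⟩

/-- A morphism as a map onto its image. -/
noncomputable def Hom.rangeRestrict (f : Hom E F) : Hom E f.range.toSubmodule where
  toLinearMap := f.toLinearMap.rangeRestrict
  map_a x := Subtype.ext (f.map_a x)

/-- The kernel of a morphism. -/
noncomputable def Hom.ker (f : Hom E F) : ABSubmodule E where
  toSubmodule := LinearMap.ker f.toLinearMap
  a_mem := by
    intro x hx
    rw [LinearMap.mem_ker] at hx ⊢
    rw [f.map_a, hx, map_zero]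

/-- The intersection of a family of sub-modules. -/
noncomputable def ABSubmodule.iInf {ι : Sort*} (P : ι → ABSubmodule E) : ABSubmodule E where
  toSubmodule := ⨅ i, (P i).toSubmodule
  a_mem := by
    intro x hx
    rw [Submodule.mem_iInf] at hx ⊢
    exact fun i => (P i).a_mem x (hx i)

/-- The elements of which a multiple by a power of `b` lies in `P`. -/
noncomputable def ABSubmodule.saturation (P : ABSubmodule E) : ABSubmodule E where
  carrier := {x | ∃ n : ℕ, (PowerSeries.X ^ n : ℂ⟦X⟧) • x ∈ P.toSubmodule}
  zero_mem' := ⟨0, by simp⟩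
  add_mem' := by
    rintro x y ⟨n, hn⟩ ⟨m, hm⟩
    refine ⟨n + m, ?_⟩
    rw [smul_add]
    refine add_mem ?_ ?_
    · rw [add_comm, pow_add, mul_smul]; exact Submodule.smul_mem _ _ hn
    · rw [pow_add, mul_smul]; exact Submodule.smul_mem _ _ hm
  smul_mem' := by
    rintro S x ⟨n, hn⟩
    exact ⟨n, by rw [smul_comm]; exact Submodule.smul_mem _ _ hn⟩
  a_mem := by
    rintro x ⟨n, hn⟩
    refine ⟨n, ?_⟩
    have h := P.a_mem _ hn
    -- Here `a (b^n x) = b^n a x + n b (b^n x)`, and the last term is already in `P`: the same `n`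
    -- serves for `a x`.
    rw [a_X_pow_smul, smul_add] at h
    refine (Submodule.add_mem_iff_left _ ?_).mp h
    rw [smul_comm, smul_comm _ (PowerSeries.X : ℂ⟦X⟧)]
    exact Submodule.smul_mem _ _ (Submodule.smul_mem _ _ hn)

theorem ABSubmodule.le_saturation (P : ABSubmodule E) :
    P.toSubmodule ≤ P.saturation.toSubmodule := fun x hx => ⟨0, by simpa using hx⟩

theorem ABSubmodule.mem_saturation_of_X_smul {P : ABSubmodule E} {x : E}
    (h : (PowerSeries.X : ℂ⟦X⟧) • x ∈ P.saturation.toSubmodule) :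
    x ∈ P.saturation.toSubmodule := by
  obtain ⟨n, hn⟩ := h
  exact ⟨n + 1, by rwa [pow_succ, mul_smul]⟩

theorem mem_generated (x : E) : x ∈ (generated x).toSubmodule := by
  change x ∈ sInf _
  rw [Submodule.mem_sInf]
  exact fun p hp => hp.1

theorem generated_le {x : E} {P : ABSubmodule E} (hx : x ∈ P.toSubmodule) :
    (generated x).toSubmodule ≤ P.toSubmodule := sInf_le ⟨hx, P.a_mem⟩

theorem evalHom_injective (hE : IsABModule E) :
    Function.Injective (evalHom E).toLinearMap := by
  have := hE.free
  rw [injective_iff_map_eq_zero]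
  intro x hx
  refine (forall_dual_apply_eq_zero_iff ℂ⟦X⟧ x).mp fun φ => ?_
  exact LinearMap.congr_fun hx φ

end Homs

/-! ### Semi-simplicity by families of morphisms; modules of rank one. -/

section

variable {E : Type u} [AddCommGroup E] [Module ℂ⟦X⟧ E] [ABAction E]

theorem IsRegular.of_injective {F : Type u} [AddCommGroup F] [Module ℂ⟦X⟧ F] [ABAction F]
    (hF : IsRegular F) (f : Hom E F) (hf : Function.Injective f.toLinearMap) :
    IsRegular E := by
  obtain ⟨hF, G, _, _, _, hG, hs, g, hg⟩ := hF
  exact ⟨hF.of_injective _ hf, G, _, _, _, hG, hs, g.comp f, hg.comp hf⟩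

/-- An embedding in a direct sum is a family of morphisms with no common kernel. In this form the
index set is arbitrary and members of the family can be discarded. -/
theorem isSemisimple_of_jointly_injective {ι : Type*} [Finite ι] (L : ι → Type)
    [∀ i, AddCommGroup (L i)] [∀ i, Module ℂ⟦X⟧ (L i)] [∀ i, ABAction (L i)]
    (hL : ∀ i, IsRegular (L i) ∧ finrank ℂ⟦X⟧ (L i) = 1) (f : ∀ i, Hom E (L i))
    (hf : ∀ x, (∀ i, (f i).toLinearMap x = 0) → x = 0) : IsSemisimple E := by
  obtain ⟨n, ⟨e⟩⟩ := Finite.exists_equiv_fin ι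
  refine ⟨n, fun k => L (e.symm k), inferInstance, inferInstance, inferInstance,
    fun k => hL _, ⟨LinearMap.pi fun k => (f (e.symm k)).toLinearMap, fun x => ?_⟩, ?_⟩
  · funext k
    exact (f (e.symm k)).map_a x
  · rw [injective_iff_map_eq_zero]
    intro x hx
    refine hf x fun i => ?_
    have h := congrFun hx (e i)
    change (f (e.symm (e i))).toLinearMap x = 0 at h
    rwa [e.symm_apply_apply] at h

theorem IsSemisimple.exists_jointly_injective (hE : IsSemisimple E) :
    ∃ (n : ℕ) (L : Fin n → Type) (_ : ∀ i, AddCommGroup (L i)) (_ : ∀ i, Module ℂ⟦X⟧ (L i))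
      (_ : ∀ i, ABAction (L i)),
      (∀ i, IsRegular (L i) ∧ finrank ℂ⟦X⟧ (L i) = 1) ∧
      ∃ f : ∀ i, Hom E (L i), ∀ x, (∀ i, (f i).toLinearMap x = 0) → x = 0 := by
  obtain ⟨n, L, _, _, _, hL, f, hf⟩ := hE
  refine ⟨n, L, _, _, _, hL, fun i => ⟨LinearMap.proj i ∘ₗ f.toLinearMap, fun x => ?_⟩, ?_⟩
  · exact congrFun (f.map_a x) i
  · intro x hx
    refine hf ?_
    rw [map_zero]
    funext i
    exact hx i

theorem IsSemisimple.of_jointly_injective {ι : Type*} [Finite ι] (Q : ι → Type v)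
    [∀ i, AddCommGroup (Q i)] [∀ i, Module ℂ⟦X⟧ (Q i)] [∀ i, ABAction (Q i)]
    (hQ : ∀ i, IsSemisimple (Q i)) (f : ∀ i, Hom E (Q i))
    (hf : ∀ x, (∀ i, (f i).toLinearMap x = 0) → x = 0) : IsSemisimple E := by
  choose n L i₁ i₂ i₃ hL g hg using fun i => (hQ i).exists_jointly_injective
  refine isSemisimple_of_jointly_injective (ι := Σ i, Fin (n i)) (fun p => L p.1 p.2)
    (fun p => hL p.1 p.2) (fun p => (g p.1 p.2).comp (f p.1)) fun x hx => ?_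
  exact hf x fun i => hg i _ fun j => hx ⟨i, j⟩

theorem IsSemisimple.of_injective {F : Type v} [AddCommGroup F] [Module ℂ⟦X⟧ F] [ABAction F]
    (hF : IsSemisimple F) (f : Hom E F) (hf : Function.Injective f.toLinearMap) :
    IsSemisimple E :=
  .of_jointly_injective (fun _ : Unit => F) (fun _ => hF) (fun _ => f) fun x hx =>
    hf (by rw [hx (), map_zero])

theorem IsSemisimple.of_isRegular_of_finrank_eq_one {L : Type} [AddCommGroup L]
    [Module ℂ⟦X⟧ L] [ABAction L] (hL : IsRegular L) (h1 : finrank ℂ⟦X⟧ L = 1) :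
    IsSemisimple L :=
  isSemisimple_of_jointly_injective (fun _ : Unit => L) (fun _ => ⟨hL, h1⟩)
    (fun _ => Hom.id L) fun _ hx => hx ()

/-- Two elements of a module of rank one, the first nonzero, are proportional up to powers
of `b`. -/
theorem exists_X_pow_smul_eq_smul {L : Type*} [AddCommGroup L] [Module ℂ⟦X⟧ L] [ABAction L]
    (hL : IsABModule L) (h1 : finrank ℂ⟦X⟧ L = 1) {x : L} (hx : x ≠ 0) :
    ∃ n : ℕ, ∀ y : L, ∃ S : ℂ⟦X⟧, (PowerSeries.X ^ n : ℂ⟦X⟧) • y = S • x := by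
  have := hL.free
  have := hL.finite
  let e := finBasisOfFinrankEq ℂ⟦X⟧ L h1
  have he : ∀ y : L, y = e.repr y 0 • e 0 := fun y => by
    simpa using (e.sum_repr y).symm
  have hx0 : e.repr x 0 ≠ 0 := by
    intro h
    apply hx
    rw [he x, h, zero_smul]
  obtain ⟨n, w, hw⟩ := exists_eq_X_pow_mul_unit hx0
  refine ⟨n, fun y => ⟨e.repr y 0 * (↑w⁻¹ : ℂ⟦X⟧), ?_⟩⟩
  rw [he x, hw, he y]
  simp only [map_smul, Basis.repr_self, Finsupp.smul_apply, Finsupp.single_eq_same, smul_eq_mul,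
    mul_one, smul_smul]
  congr 1
  linear_combination (-(PowerSeries.X ^ n * e.repr y 0)) * w.mul_inv

theorem finrank_eq_one_of_injective {L R : Type*} [AddCommGroup L] [Module ℂ⟦X⟧ L] [ABAction L]
    [AddCommGroup R] [Module ℂ⟦X⟧ R] [Nontrivial R]
    (hL : IsABModule L) (h1 : finrank ℂ⟦X⟧ L = 1) (f : R →ₗ[ℂ⟦X⟧] L)
    (hf : Function.Injective f) : finrank ℂ⟦X⟧ R = 1 := by
  have := hL.free
  have := hL.finite
  have := hL.isNoetherian
  have : Module.Finite ℂ⟦X⟧ R := Module.Finite.of_injective f hf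
  have := hL.isTorsionFree
  have : IsTorsionFree ℂ⟦X⟧ R := hf.moduleIsTorsionFree f (map_smul f)
  refine le_antisymm ?_ ?_
  · rw [← h1]; exact LinearMap.finrank_le_finrank_of_injective hf
  · exact Module.finrank_pos

end

/-! ### Regularity of duals and of saturated quotients. -/

section

variable {E : Type u} [AddCommGroup E] [Module ℂ⟦X⟧ E] [ABAction E]

theorem Hom.dual_injective_of_cofinal {F : Type v} [AddCommGroup F] [Module ℂ⟦X⟧ F]
    [ABAction F] (f : Hom F E)
    (hf : ∀ x : E, ∃ n : ℕ, (PowerSeries.X ^ n : ℂ⟦X⟧) • x ∈ f.range.toSubmodule) :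
    Function.Injective f.dual.toLinearMap := by
  rw [injective_iff_map_eq_zero]
  intro φ hφ
  refine dual_eq_zero_of_cofinal _ hf φ ?_
  rintro _ ⟨y, rfl⟩
  exact LinearMap.congr_fun hφ y

/-- The dual of a module with a simple pole has a simple pole. -/
theorem HasSimplePole.dual (hE : HasSimplePole E) :
    HasSimplePole (Dual ℂ⟦X⟧ E) := by
  choose t ht using hE
  intro φ
  have hX : (PowerSeries.X : ℂ⟦X⟧) ≠ 0 := PowerSeries.X_ne_zero
  -- The chosen `t` plays the role of `b⁻¹ a` but is not known to be additive. Linearity of the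
  -- quotient form is checked after multiplication by `b`, where `t` disappears.
  have key : ∀ x, a φ x = PowerSeries.X *
      (PowerSeries.X * PowerSeries.derivative ℂ (φ x) - φ (t x)) := by
    intro x
    rw [dual_a_apply, ht, map_smul, smul_eq_mul]
    ring
  refine ⟨⟨⟨fun x => PowerSeries.X * PowerSeries.derivative ℂ (φ x) - φ (t x), ?_⟩, ?_⟩, ?_⟩
  · intro x y
    apply mul_left_cancel₀ hX
    rw [mul_add, ← key, ← key, ← key, map_add]
  · intro S x
    apply mul_left_cancel₀ hX
    change _ = PowerSeries.X * (S * _)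
    rw [mul_left_comm, ← key, ← key, map_smul, smul_eq_mul]
  · ext1 x
    exact key x

/-- A regular module contains, up to a power of `b`, a module with a simple pole. -/
theorem IsRegular.exists_simplePole (hE : IsRegular E) :
    ∃ (G : ABSubmodule E) (N : ℕ), HasSimplePole G.toSubmodule ∧
      ∀ x : E, (PowerSeries.X ^ N : ℂ⟦X⟧) • x ∈ G.toSubmodule := by
  obtain ⟨hE, F, _, _, _, hF, hs, f, hf⟩ := hE
  have := hF.isNoetherian
  -- `T n` is the set of `x` in `F` with `b^n x` in `E`. If this chain is stationary from `N` on, `G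
  -- = E ∩ b^N F` has a simple pole: for `x = b^N y` in `G`, `a x = b^(N+1) u` lies in `E`, so `u ∈
  -- T (N+1) = T N`, and `w = b^N u` is in `G` with `a x = b w`.
  let T : ℕ →o Submodule ℂ⟦X⟧ F :=
    { toFun := fun n => (LinearMap.range f.toLinearMap).comap
        (LinearMap.lsmul ℂ⟦X⟧ F (PowerSeries.X ^ n))
      monotone' := monotone_nat_of_le_succ fun n x hx => by
        simp only [Submodule.mem_comap, LinearMap.lsmul_apply] at hx ⊢
        rw [pow_succ', mul_smul]
        exact Submodule.smul_mem _ _ hx }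
  have hT : ∀ n x, x ∈ T n ↔ ∃ y, f.toLinearMap y = (PowerSeries.X ^ n : ℂ⟦X⟧) • x :=
    fun n x => Iff.rfl
  obtain ⟨N, hN⟩ := monotone_stabilizes_iff_noetherian.mpr this T
  let G : Submodule ℂ⟦X⟧ E := (LinearMap.range
    (LinearMap.lsmul ℂ⟦X⟧ F (PowerSeries.X ^ N))).comap f.toLinearMap
  have hG : ∀ x, x ∈ G ↔ ∃ y, (PowerSeries.X ^ N : ℂ⟦X⟧) • y = f.toLinearMap x :=
    fun x => Iff.rfl
  have key : ∀ x ∈ G, ∃ z ∈ G, a x = (PowerSeries.X : ℂ⟦X⟧) • z := by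
    intro x hx
    obtain ⟨y, hy⟩ := (hG x).mp hx
    obtain ⟨z, hz⟩ := hs y
    have h1 : f.toLinearMap (a x) =
        (PowerSeries.X ^ (N + 1) : ℂ⟦X⟧) • (z + (N : ℂ⟦X⟧) • y) := by
      rw [f.map_a, ← hy, a_X_pow_smul, hz, smul_comm (N : ℂ⟦X⟧), ← smul_add, smul_smul, pow_succ]
    have h2 : z + (N : ℂ⟦X⟧) • y ∈ T (N + 1) := (hT _ _).mpr ⟨a x, h1⟩
    rw [← hN (N + 1) N.le_succ] at h2
    obtain ⟨w, hw⟩ := (hT _ _).mp h2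
    refine ⟨w, (hG w).mpr ⟨_, hw.symm⟩, hf ?_⟩
    rw [h1, map_smul, hw, smul_smul, pow_succ']
  refine ⟨⟨G, fun x hx => ?_⟩, N, ?_, ?_⟩
  · obtain ⟨z, hz, h⟩ := key x hx
    rw [h]
    exact G.smul_mem _ hz
  · intro x
    obtain ⟨z, hz, h⟩ := key x x.2
    exact ⟨⟨z, hz⟩, Subtype.ext h⟩
  · intro x
    exact (hG _).mpr ⟨f.toLinearMap x, (map_smul _ _ _).symm⟩

theorem IsRegular.dual (hE : IsRegular E) : IsRegular (Dual ℂ⟦X⟧ E) := by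
  obtain ⟨G, N, hG, hN⟩ := hE.exists_simplePole
  have hGf := hE.1.sub G
  refine ⟨hE.1.dual, Dual ℂ⟦X⟧ G.toSubmodule, inferInstance, inferInstance, inferInstance,
    hGf.dual, hG.dual, G.subtypeHom.dual, ?_⟩
  refine Hom.dual_injective_of_cofinal _ fun x => ⟨N, ?_⟩
  exact ⟨⟨_, hN x⟩, rfl⟩

/-- The quotient of a regular module by a saturated sub-module is regular. -/
theorem IsRegular.quotient (hE : IsRegular E) (P : ABSubmodule E)
    (h : ∀ x : E, (PowerSeries.X : ℂ⟦X⟧) • x ∈ P.toSubmodule → x ∈ P.toSubmodule) :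
    IsRegular (E ⧸ P.toSubmodule) := by
  have hpow : ∀ (n : ℕ) (x : E), (PowerSeries.X ^ n : ℂ⟦X⟧) • x ∈ P.toSubmodule →
      x ∈ P.toSubmodule := by
    intro n
    induction n with
    | zero => intro x hx; simpa using hx
    | succ n ih =>
      intro x hx
      rw [pow_succ, mul_smul] at hx
      exact h x (ih _ hx)
  obtain ⟨hE, F, _, _, _, hF, hs, f, hf⟩ := hE
  -- The image of `P` need not be saturated in `F`, so `F` is divided by its saturation. As `P` is
  -- saturated in `E`, this saturation meets `E` only in `P`, and the induced map of quotients stays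
  -- injective.
  have hmem : ∀ x, f.toLinearMap x ∈ (P.map f).saturation.toSubmodule → x ∈ P.toSubmodule := by
    rintro x ⟨n, y, hy, hyx⟩
    rw [← map_smul] at hyx
    refine hpow n x ?_
    rw [← hf hyx]
    exact hy
  refine ⟨hE.quotient P h, F ⧸ (P.map f).saturation.toSubmodule, inferInstance, inferInstance,
    inferInstance, hF.quotient _ fun x => ABSubmodule.mem_saturation_of_X_smul, ?_,
    ⟨Submodule.mapQ _ _ f.toLinearMap ?_, ?_⟩, ?_⟩
  · intro x
    obtain ⟨x, rfl⟩ := Submodule.Quotient.mk_surjective _ x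
    obtain ⟨y, hy⟩ := hs x
    exact ⟨Submodule.Quotient.mk y, congrArg Submodule.Quotient.mk hy⟩
  · intro x hx
    exact (P.map f).le_saturation ⟨x, hx, rfl⟩
  · intro x
    obtain ⟨x, rfl⟩ := Submodule.Quotient.mk_surjective _ x
    exact congrArg Submodule.Quotient.mk (f.map_a x)
  · rw [injective_iff_map_eq_zero]
    intro x hx
    obtain ⟨x, rfl⟩ := Submodule.Quotient.mk_surjective _ x
    exact (Submodule.Quotient.mk_eq_zero _).mpr
      (hmem x ((Submodule.Quotient.mk_eq_zero _).mp hx))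

end

/-! ### Duals and quotients of semi-simple modules. -/

section

variable {E : Type u} [AddCommGroup E] [Module ℂ⟦X⟧ E] [ABAction E]

/-- A morphism whose kernel contains that of a morphism `f` factors through the image of `f`. -/
theorem exists_hom_range {F : Type*} [AddCommGroup F] [Module ℂ⟦X⟧ F] [ABAction F]
    {G : Type*} [AddCommGroup G] [Module ℂ⟦X⟧ G] [ABAction G] (f : Hom E F) (g : Hom E G)
    (h : ∀ x, f.toLinearMap x = 0 → g.toLinearMap x = 0) :
    ∃ k : Hom f.range.toSubmodule G,
      ∀ x, k.toLinearMap (f.rangeRestrict.toLinearMap x) = g.toLinearMap x := by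
  have hwd : ∀ x y, f.toLinearMap x = f.toLinearMap y → g.toLinearMap x = g.toLinearMap y := by
    intro x y hxy
    rw [← sub_eq_zero, ← map_sub]
    exact h _ (by rw [map_sub, hxy, sub_self])
  have hs : ∀ y : f.range.toSubmodule, ∃ x, f.toLinearMap x = (y : F) := fun y => y.2
  choose s hs using hs
  have hk : ∀ x, g.toLinearMap (s (f.rangeRestrict.toLinearMap x)) = g.toLinearMap x :=
    fun x => hwd _ _ (hs _)
  refine ⟨⟨⟨⟨fun y => g.toLinearMap (s y), fun x y => ?_⟩, fun S x => ?_⟩, fun x => ?_⟩, hk⟩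
  · rw [← map_add]
    exact hwd _ _ (by rw [map_add, hs, hs, hs]; rfl)
  · rw [RingHom.id_apply, ← map_smul]
    exact hwd _ _ (by rw [map_smul, hs, hs]; rfl)
  · change g.toLinearMap (s (a x)) = a (g.toLinearMap (s x))
    rw [← g.map_a]
    exact hwd _ _ (by rw [f.map_a, hs, hs]; rfl)

/-- A semi-simple module contains, up to powers of `b`, a finite direct sum of regular modules
of rank one. -/
theorem IsSemisimple.exists_cofinal (hE : IsSemisimple E) :
    ∃ (ι : Type) (_ : Finite ι) (R : ι → Type) (_ : ∀ i, AddCommGroup (R i))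
      (_ : ∀ i, Module ℂ⟦X⟧ (R i)) (_ : ∀ i, ABAction (R i)),
      (∀ i, IsRegular (R i) ∧ finrank ℂ⟦X⟧ (R i) = 1) ∧
      ∃ g : ∀ i, Hom (R i) E, ∀ x : E, ∃ n : ℕ,
        (PowerSeries.X ^ n : ℂ⟦X⟧) • x ∈ ⨆ i, (g i).range.toSubmodule := by
  classical
  obtain ⟨n, L, _, _, _, hL, f, hf⟩ := hE.exists_jointly_injective
  -- A minimal jointly injective subfamily: dropping `i` creates a common kernel, hence an `x i`
  -- killed by every member except `f i`.
  have hwf : ∃ I : Finset (Fin n), (∀ x, (∀ i ∈ I, (f i).toLinearMap x = 0) → x = 0) ∧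
      ∀ J ⊂ I, ¬ ∀ x, (∀ i ∈ J, (f i).toLinearMap x = 0) → x = 0 := by
    obtain ⟨I, hI⟩ := exists_minimal_of_wellFoundedLT
      (fun I : Finset (Fin n) => ∀ x, (∀ i ∈ I, (f i).toLinearMap x = 0) → x = 0)
      ⟨Finset.univ, fun x hx => hf x fun i => hx i (Finset.mem_univ i)⟩
    exact ⟨I, hI.prop, fun J hJ h => hJ.not_ge (hI.le_of_le h hJ.le)⟩
  obtain ⟨I, hI, hmin⟩ := hwf
  have hex : ∀ i : I, ∃ x : E, (∀ j ∈ I, j ≠ i → (f j).toLinearMap x = 0) ∧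
      (f i).toLinearMap x ≠ 0 := by
    intro i
    have h := hmin _ (Finset.erase_ssubset i.2)
    push Not at h
    obtain ⟨x, hx, hx0⟩ := h
    refine ⟨x, fun j hj hji => hx j (Finset.mem_erase.mpr ⟨hji, hj⟩), fun h0 => hx0 ?_⟩
    refine hI x fun j hj => ?_
    by_cases hji : j = i
    · rw [hji]; exact h0
    · exact hx j (Finset.mem_erase.mpr ⟨hji, hj⟩)
  choose x hx hx0 using hex
  let K : I → ABSubmodule E := fun i =>
    ABSubmodule.iInf fun j : {j : I // j ≠ i} => (f j.1).ker
  have hK : ∀ i y, y ∈ (K i).toSubmodule ↔ ∀ j ∈ I, j ≠ i → (f j).toLinearMap y = 0 := by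
    intro i y
    refine (Submodule.mem_iInf _).trans ⟨fun h j hj hji => ?_, fun h j => ?_⟩
    · exact h ⟨⟨j, hj⟩, fun e => hji (congrArg Subtype.val e)⟩
    · exact h _ j.1.2 fun e => j.2 (Subtype.ext e)
  have hinj : ∀ i, ∀ y ∈ (K i).toSubmodule, (f i).toLinearMap y = 0 → y = 0 := by
    intro i y hy h0
    refine hI y fun j hj => ?_
    by_cases hji : j = i
    · rw [hji]; exact h0
    · exact (hK i y).mp hy j hj hji
  -- `f i` is injective on `K i`. The summand is taken to be its image in `L i`, which lives in the
  -- lowest universe as `IsSemisimple` requires; `g i` is the inverse map back into `E`.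
  let φ : ∀ i : I, Hom (K i).toSubmodule (L i) := fun i => (f i).comp (K i).subtypeHom
  have hg := fun i : I => exists_hom_range (φ i) (K i).subtypeHom fun y hy => hinj i y y.2 hy
  choose g hg using hg
  refine ⟨I, inferInstance, fun i => (φ i).range.toSubmodule, inferInstance, inferInstance,
    inferInstance, fun i => ⟨?_, ?_⟩, g, fun y => ?_⟩
  · exact (hL i).1.of_injective (φ i).range.subtypeHom
      (Submodule.injective_subtype _)
  · have : Nontrivial (φ i).range.toSubmodule :=
      nontrivial_of_ne ⟨_, ⟨x i, (hK i _).mpr (hx i)⟩, rfl⟩ 0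
        fun h => hx0 i (congrArg Subtype.val h)
    exact finrank_eq_one_of_injective (hL i).1.1 (hL i).2 _
      (Submodule.injective_subtype (φ i).range.toSubmodule)
  · choose m hm using fun i : I => exists_X_pow_smul_eq_smul (hL i).1.1 (hL i).2 (hx0 i)
    choose S hS using fun i : I => hm i ((f i).toLinearMap y)
    let N := ∑ i, m i
    have hN : ∀ i, m i ≤ N := fun i =>
      Finset.single_le_sum (f := m) (fun _ _ => Nat.zero_le _) (Finset.mem_univ i)
    have hsum : (PowerSeries.X ^ N : ℂ⟦X⟧) • y =
        ∑ i, (PowerSeries.X ^ (N - m i) * S i) • x i := by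
      -- By joint injectivity it suffices to apply each `f j`, under which only the term `i = j`
      -- survives.
      rw [← sub_eq_zero]
      refine hI _ fun j hj => ?_
      rw [map_sub, map_sum, Finset.sum_eq_single ⟨j, hj⟩]
      · have h := hS ⟨j, hj⟩
        simp only at h
        rw [map_smul, map_smul, mul_smul, ← h, smul_smul, ← pow_add, Nat.sub_add_cancel (hN _),
          sub_self]
      · intro i _ hij
        rw [map_smul, hx i j hj fun e => hij (Subtype.ext e.symm), smul_zero]
      · exact fun h => absurd (Finset.mem_univ _) h
    refine ⟨N, ?_⟩
    rw [hsum]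
    refine Submodule.sum_mem _ fun i _ => Submodule.smul_mem _ _ ?_
    refine Submodule.mem_iSup_of_mem i ?_
    have hxi : x i ∈ (K i).toSubmodule := (hK i _).mpr (hx i)
    exact ⟨_, hg i ⟨x i, hxi⟩⟩

theorem jointly_injective_dual {ι : Type*} (Q : ι → Type v)
    [∀ i, AddCommGroup (Q i)] [∀ i, Module ℂ⟦X⟧ (Q i)] [∀ i, ABAction (Q i)]
    (g : ∀ i, Hom (Q i) E)
    (hg : ∀ x : E, ∃ n : ℕ, (PowerSeries.X ^ n : ℂ⟦X⟧) • x ∈ ⨆ i, (g i).range.toSubmodule)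
    (ψ : Dual ℂ⟦X⟧ E) (hψ : ∀ i, (g i).dual.toLinearMap ψ = 0) : ψ = 0 := by
  refine dual_eq_zero_of_cofinal _ hg ψ fun x hx => ?_
  have hle : ⨆ i, (g i).range.toSubmodule ≤ LinearMap.ker ψ := by
    refine iSup_le fun i => ?_
    rintro _ ⟨y, rfl⟩
    exact LinearMap.congr_fun (hψ i) y
  exact hle hx

/-- The dual of a semi-simple module is semi-simple. -/
theorem IsSemisimple.dual (hE : IsSemisimple E) : IsSemisimple (Dual ℂ⟦X⟧ E) := by
  obtain ⟨ι, _, R, _, _, _, hR, g, hg⟩ := hE.exists_cofinal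
  refine isSemisimple_of_jointly_injective (fun i => Dual ℂ⟦X⟧ (R i)) (fun i => ⟨?_, ?_⟩)
    (fun i => (g i).dual) (jointly_injective_dual R g hg)
  · exact (hR i).1.dual
  · have := (hR i).1.1.free
    have := (hR i).1.1.finite
    rw [Module.finrank_linearMap_self, (hR i).2]

/-- Freeness embeds `E` in its bidual, the dual of a semi-simple module. -/
theorem IsABModule.isSemisimple_of_dual (hE : IsABModule E)
    (h : IsSemisimple (Dual ℂ⟦X⟧ E)) : IsSemisimple E :=
  h.dual.of_injective (evalHom E) (evalHom_injective hE)

/-- A module which is, up to powers of `b`, the sum of images of semi-simple modules is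
semi-simple. -/
theorem IsABModule.isSemisimple_of_cofinal (hE : IsABModule E) {ι : Type*} [Finite ι]
    (Q : ι → Type v) [∀ i, AddCommGroup (Q i)] [∀ i, Module ℂ⟦X⟧ (Q i)] [∀ i, ABAction (Q i)]
    (hQ : ∀ i, IsSemisimple (Q i)) (g : ∀ i, Hom (Q i) E)
    (hg : ∀ x : E, ∃ n : ℕ, (PowerSeries.X ^ n : ℂ⟦X⟧) • x ∈ ⨆ i, (g i).range.toSubmodule) :
    IsSemisimple E :=
  hE.isSemisimple_of_dual <| .of_jointly_injective (fun i => Dual ℂ⟦X⟧ (Q i))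
    (fun i => (hQ i).dual) (fun i => (g i).dual) (jointly_injective_dual Q g hg)

theorem IsABModule.isSemisimple_of_cofinal_hom (hE : IsABModule E) {Q : Type v}
    [AddCommGroup Q] [Module ℂ⟦X⟧ Q] [ABAction Q] (hQ : IsSemisimple Q) (g : Hom Q E)
    (hg : ∀ x : E, ∃ n : ℕ, (PowerSeries.X ^ n : ℂ⟦X⟧) • x ∈ g.range.toSubmodule) :
    IsSemisimple E := by
  refine hE.isSemisimple_of_cofinal (fun _ : Unit => Q) (fun _ => hQ) (fun _ => g) fun x => ?_
  simpa using hg x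

/-! ### The semi-simple part and the semi-simple filtration. -/

theorem le_ssPart {P : ABSubmodule E} (hP : IsSemisimple P.toSubmodule) :
    P.toSubmodule ≤ (ssPart E).toSubmodule := fun _ hx =>
  Submodule.subset_span (hP.of_injective (ABSubmodule.inclusionHom (generated_le hx))
    (Submodule.inclusion_injective (generated_le hx)))

/-- By noetherianity finitely many semi-simple elements span, so the semi-simple part is a finite
sum of semi-simple sub-modules. -/
theorem IsABModule.isSemisimple_ssPart (hE : IsABModule E) :
    IsSemisimple (ssPart E).toSubmodule := by
  have := hE.isNoetherian
  obtain ⟨s, hs, hspan⟩ := (Submodule.fg_span_iff_fg_span_finset_subset (R := ℂ⟦X⟧)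
    {x : E | IsSemisimpleElement x}).mp (IsNoetherian.noetherian _)
  have hmem : ∀ x ∈ s, x ∈ (ssPart E).toSubmodule := fun _ hx => Submodule.subset_span (hs hx)
  refine (hE.sub _).isSemisimple_of_cofinal (fun x : s => (generated (x : E)).toSubmodule)
    (fun x => hs x.2) (fun x => ABSubmodule.inclusionHom (generated_le (hmem x x.2)))
    fun y => ⟨0, ?_⟩
  rw [pow_zero, one_smul]
  obtain ⟨y, hy⟩ := y
  have hy' : y ∈ Submodule.span ℂ⟦X⟧ (s : Set E) := by rw [← hspan]; exact hy
  have hle : Submodule.span ℂ⟦X⟧ (s : Set E) ≤ (⨆ x : s, (ABSubmodule.inclusionHom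
      (generated_le (hmem x x.2))).range.toSubmodule).map (ssPart E).toSubmodule.subtype := by
    refine Submodule.span_le.mpr fun x hx => ?_
    refine ⟨⟨x, hmem x hx⟩, Submodule.mem_iSup_of_mem ⟨x, hx⟩ ?_, rfl⟩
    exact ⟨⟨x, mem_generated x⟩, rfl⟩
  obtain ⟨z, hz, hzy⟩ := hle hy'
  rwa [← (Subtype.ext hzy : z = ⟨y, hy⟩)]

/-- The saturation of the semi-simple part is again semi-simple, since the semi-simple part is
cofinal in it; by maximality the two coincide. -/
theorem IsABModule.mem_ssPart_of_X_smul (hE : IsABModule E) {x : E}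
    (hx : (PowerSeries.X : ℂ⟦X⟧) • x ∈ (ssPart E).toSubmodule) : x ∈ (ssPart E).toSubmodule := by
  have h := (hE.sub (ssPart E).saturation).isSemisimple_of_cofinal_hom hE.isSemisimple_ssPart
    (ABSubmodule.inclusionHom (ssPart E).le_saturation) fun y => by
      obtain ⟨n, hn⟩ := y.2
      exact ⟨n, ⟨_, hn⟩, rfl⟩
  exact le_ssPart h ⟨1, by rwa [pow_one]⟩

theorem mem_ssFiltration_succ {j : ℕ} {x : E} :
    x ∈ (ssFiltration E (j + 1)).toSubmodule ↔
      Submodule.Quotient.mk x ∈ (ssPart (E ⧸ (ssFiltration E j).toSubmodule)).toSubmodule :=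
  Iff.rfl

/-- Saturation keeps every `E / S_j(E)` torsion-free, hence an (a,b)-module, and this feeds the next
step of the induction. -/
theorem IsABModule.mem_ssFiltration_of_X_smul (hE : IsABModule E) (j : ℕ) :
    ∀ x : E, (PowerSeries.X : ℂ⟦X⟧) • x ∈ (ssFiltration E j).toSubmodule →
      x ∈ (ssFiltration E j).toSubmodule := by
  induction j with
  | zero =>
    intro x hx
    change _ ∈ (⊥ : Submodule ℂ⟦X⟧ E) at hx
    change _ ∈ (⊥ : Submodule ℂ⟦X⟧ E)
    rw [Submodule.mem_bot] at hx ⊢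
    exact hE.smul_left_cancel PowerSeries.X_ne_zero (by rw [hx, smul_zero])
  | succ j ih =>
    intro x hx
    exact (hE.quotient _ ih).mem_ssPart_of_X_smul hx

theorem IsABModule.quotient_ssFiltration (hE : IsABModule E) (j : ℕ) :
    IsABModule (E ⧸ (ssFiltration E j).toSubmodule) :=
  hE.quotient _ (hE.mem_ssFiltration_of_X_smul j)

theorem ssFiltration_le_succ (j : ℕ) :
    (ssFiltration E j).toSubmodule ≤ (ssFiltration E (j + 1)).toSubmodule := by
  intro x hx
  rw [mem_ssFiltration_succ, (Submodule.Quotient.mk_eq_zero _).mpr hx]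
  exact zero_mem _

end

/-! ### Eigenvectors in simple pole modules and nonvanishing of the semi-simple part. -/

theorem exists_eigenvalue_sub_natCast_surjective {V : Type*} [AddCommGroup V] [Module ℂ V]
    [FiniteDimensional ℂ V] [Nontrivial V] (T : End ℂ V) :
    ∃ (c : ℂ) (v : V), v ≠ 0 ∧ T v = c • v ∧
      ∀ n : ℕ, 0 < n → ∀ r : V, ∃ z : V, T z + (n : ℂ) • z - c • z = r := by
  obtain ⟨c₀, hc₀⟩ := T.exists_eigenvalue
  -- With minimal real part, no `c - n` with `n > 0` is an eigenvalue, so `T + n - c` is invertible.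
  -- This removes every obstruction to lifting an eigenvector order by order in `b`.
  obtain ⟨c, hc, hmin⟩ := Set.exists_min_image _ Complex.re T.finite_hasEigenvalue ⟨c₀, hc₀⟩
  obtain ⟨v, hv⟩ := hc.exists_hasEigenvector
  refine ⟨c, v, hv.2, hv.apply_eq_smul, fun n hn => ?_⟩
  have hn' : ¬ T.HasEigenvalue (c - n) := fun h => by
    have h1 := hmin _ h
    simp only [Complex.sub_re, Complex.natCast_re] at h1
    have h2 : (0 : ℝ) < n := by exact_mod_cast hn
    linarith
  let A : V →ₗ[ℂ] V := T + (n : ℂ) • LinearMap.id - c • LinearMap.id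
  have hA : Function.Injective A := by
    rw [injective_iff_map_eq_zero]
    intro x hx
    by_contra hx0
    refine hn' (End.hasEigenvalue_of_hasEigenvector (x := x) ⟨End.mem_eigenspace_iff.mpr ?_, hx0⟩)
    have hx' : T x + (n : ℂ) • x - c • x = 0 := hx
    rw [sub_smul, ← sub_eq_zero, ← hx']
    abel
  exact fun r => LinearMap.injective_iff_surjective.mp hA r

/-- Convergence of `∑ b^k z_k`: the coefficient of degree `m` involves only the terms `k ≤ m`. -/
theorem exists_powerSeries_sum (z : ℕ → ℂ⟦X⟧) : ∃ s : ℂ⟦X⟧, ∀ n : ℕ,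
    (PowerSeries.X ^ n : ℂ⟦X⟧) ∣ s - ∑ k ∈ Finset.range n, PowerSeries.X ^ k * z k := by
  refine ⟨PowerSeries.mk fun m => ∑ k ∈ Finset.range (m + 1),
    PowerSeries.coeff m (PowerSeries.X ^ k * z k), fun n => ?_⟩
  rw [PowerSeries.X_pow_dvd_iff]
  intro m hm
  rw [map_sub, PowerSeries.coeff_mk, map_sum, sub_eq_zero]
  refine Finset.sum_subset (Finset.range_mono hm) fun k _ hk => ?_
  rw [PowerSeries.coeff_X_pow_mul', if_neg]
  simpa using hk

section

variable {F : Type*} [AddCommGroup F] [Module ℂ⟦X⟧ F] [ABAction F]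

theorem IsABModule.exists_sum (hF : IsABModule F) (z : ℕ → F) : ∃ s : F, ∀ n : ℕ, ∃ r : F,
    s = ∑ k ∈ Finset.range n, (PowerSeries.X ^ k : ℂ⟦X⟧) • z k +
      (PowerSeries.X ^ n : ℂ⟦X⟧) • r := by
  have := hF.free
  have := hF.finite
  let e := Free.chooseBasis ℂ⟦X⟧ F
  choose s hs using fun i => exists_powerSeries_sum fun k => e.repr (z k) i
  choose r hr using hs
  refine ⟨∑ i, s i • e i, fun n => ⟨∑ i, r i n • e i, e.ext_elem fun i => ?_⟩⟩
  have h := hr i n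
  rw [sub_eq_iff_eq_add'] at h
  simpa [Finsupp.single_apply] using h

theorem IsABModule.eq_zero_of_forall_X_pow (hF : IsABModule F) {x : F}
    (h : ∀ n : ℕ, ∃ y : F, x = (PowerSeries.X ^ n : ℂ⟦X⟧) • y) : x = 0 := by
  have := hF.free
  let e := Free.chooseBasis ℂ⟦X⟧ F
  refine e.ext_elem fun i => ?_
  rw [map_zero, Finsupp.zero_apply]
  ext m
  obtain ⟨y, hy⟩ := h (m + 1)
  rw [hy, map_smul, Finsupp.smul_apply, smul_eq_mul, PowerSeries.coeff_X_pow_mul', if_neg (by simp),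
    map_zero]

/-- A nonzero module with a simple pole has a nonzero element `x` with `a x = c b x`. -/
theorem HasSimplePole.exists_eigenvector [Nontrivial F] (hF : IsABModule F)
    (hs : HasSimplePole F) :
    ∃ (c : ℂ) (x : F), x ≠ 0 ∧ a x = (PowerSeries.C c * PowerSeries.X : ℂ⟦X⟧) • x := by
  have := hF.free
  have := hF.finite
  have hcancel : ∀ {x y : F}, (PowerSeries.X : ℂ⟦X⟧) • x = (PowerSeries.X : ℂ⟦X⟧) • y → x = y :=
    fun h => hF.smul_left_cancel PowerSeries.X_ne_zero h
  choose t ht using hs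
  have t_add : ∀ x y, t (x + y) = t x + t y := fun x y => hcancel (by
    rw [smul_add, ← ht, ← ht, ← ht, map_add])
  have t_smul : ∀ (S : ℂ⟦X⟧) x, t (S • x) =
      S • t x + (PowerSeries.X * PowerSeries.derivative ℂ S) • x := fun S x => hcancel (by
    rw [← ht, a_smul, ht, smul_add, smul_comm, smul_smul _ _ x, pow_two, mul_assoc])
  have t_C : ∀ (c : ℂ) x, t (PowerSeries.C c • x) = PowerSeries.C c • t x := fun c x => by
    rw [t_smul, PowerSeries.derivative_C, mul_zero, zero_smul, add_zero]
  have t_X : ∀ (n : ℕ) x, t ((PowerSeries.X ^ n : ℂ⟦X⟧) • x) =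
      (PowerSeries.X ^ n : ℂ⟦X⟧) • (t x + PowerSeries.C (n : ℂ) • x) := fun n x => hcancel (by
    rw [← ht, a_X_pow_smul, ht, smul_comm (PowerSeries.X : ℂ⟦X⟧) (PowerSeries.X ^ n : ℂ⟦X⟧),
      smul_add, smul_add _ (t x), smul_comm (n : ℂ⟦X⟧), map_natCast, smul_add])
  let e := Free.chooseBasis ℂ⟦X⟧ F
  let ι := Free.ChooseBasisIndex ℂ⟦X⟧ F
  let π : F →+ (ι → ℂ) :=
    { toFun := fun x i => PowerSeries.constantCoeff (e.repr x i)
      map_zero' := by ext; simp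
      map_add' := by intros; ext; simp }
  have π_smul : ∀ (S : ℂ⟦X⟧) x, π (S • x) = PowerSeries.constantCoeff S • π x := by
    intro S x
    ext i
    simp [π]
  have π_ker : ∀ x, π x = 0 → ∃ y, x = (PowerSeries.X : ℂ⟦X⟧) • y := by
    intro x hx
    have h : ∀ i, ∃ q, e.repr x i = PowerSeries.X * q := fun i =>
      PowerSeries.X_dvd_iff.mpr (congrFun hx i)
    choose q hq using h
    refine ⟨∑ i, q i • e i, e.ext_elem fun i => ?_⟩
    simp [hq, Finsupp.single_apply]
  let σ : (ι → ℂ) → F := fun v => ∑ i, PowerSeries.C (v i) • e i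
  have πσ : ∀ v, π (σ v) = v := by
    intro v
    ext i
    simp [π, σ, Finsupp.single_apply, apply_ite]
  have σ_add : ∀ v w, σ (v + w) = σ v + σ w := by
    intro v w
    simp [σ, add_smul, Finset.sum_add_distrib]
  have σ_smul : ∀ (c : ℂ) v, σ (c • v) = PowerSeries.C c • σ v := by
    intro c v
    simp [σ, Finset.smul_sum, smul_smul]
  -- `T` is the reduction modulo `b` of `t = b⁻¹ a`, with `π` the reduction and `σ` the lift by
  -- constants.
  let T : End ℂ (ι → ℂ) :=
    { toFun := fun v => π (t (σ v))
      map_add' := fun v w => by rw [σ_add, t_add, map_add]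
      map_smul' := fun c v => by
        rw [σ_smul, t_C, π_smul, PowerSeries.constantCoeff_C, RingHom.id_apply] }
  have πt : ∀ x, π (t x) = T (π x) := by
    intro x
    obtain ⟨y, hy⟩ := π_ker (x - σ (π x)) (by rw [map_sub, πσ, sub_self])
    rw [sub_eq_iff_eq_add] at hy
    have h := t_X 1 y
    rw [pow_one] at h
    conv_lhs => rw [hy]
    rw [t_add, h, map_add, π_smul, PowerSeries.constantCoeff_X, zero_smul, zero_add]
    rfl
  have : Nonempty ι := e.index_nonempty
  obtain ⟨c, v, hv0, hv, hsurj⟩ := exists_eigenvalue_sub_natCast_surjective T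
  let D : F → F := fun x => t x - PowerSeries.C c • x
  have D_add : ∀ x y, D (x + y) = D x + D y := fun x y => by
    simp only [D, t_add, smul_add]; abel
  have D_X : ∀ (n : ℕ) x, D ((PowerSeries.X ^ n : ℂ⟦X⟧) • x) =
      (PowerSeries.X ^ n : ℂ⟦X⟧) • (t x + PowerSeries.C (n : ℂ) • x - PowerSeries.C c • x) := by
    intro n x
    simp only [D]
    rw [t_X, smul_comm (PowerSeries.C c), ← smul_sub]
  have hstep : ∀ (n : ℕ) (r : F), ∃ z r' : F, r + (t z + PowerSeries.C ((n + 1 : ℕ) : ℂ) • z -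
      PowerSeries.C c • z) = (PowerSeries.X : ℂ⟦X⟧) • r' := by
    intro n r
    obtain ⟨z, hz⟩ := hsurj (n + 1) n.succ_pos (-π r)
    refine ⟨σ z, π_ker _ ?_⟩
    rw [map_add, map_sub, map_add, π_smul, π_smul, πt, πσ, PowerSeries.constantCoeff_C,
      PowerSeries.constantCoeff_C, hz, add_neg_cancel]
  choose z r' hr' using hstep
  obtain ⟨r₀, hr₀⟩ := π_ker (D (σ v)) (by
    rw [map_sub, πt, π_smul, πσ, hv, PowerSeries.constantCoeff_C, sub_self])
  -- `b^(n+1) r n` is the error left by the partial sum through degree `n`. The next correction `w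
  -- (n+1)` solves `(T + (n+1) - c) z = -r n` modulo `b`, which pushes the error to order `n + 2`.
  let r : ℕ → F := fun n => Nat.rec r₀ (fun n r => r' n r) n
  let w : ℕ → F := fun n => Nat.casesOn n (σ v) fun n => z n (r n)
  have hr : ∀ n, D (∑ k ∈ Finset.range (n + 1), (PowerSeries.X ^ k : ℂ⟦X⟧) • w k) =
      (PowerSeries.X ^ (n + 1) : ℂ⟦X⟧) • r n := by
    intro n
    induction n with
    | zero => simpa [w, r] using hr₀
    | succ n ih =>
      rw [Finset.sum_range_succ, D_add, ih, D_X, ← smul_add, pow_succ _ (n + 1), mul_smul]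
      exact congrArg _ (hr' n (r n))
  obtain ⟨x, hx⟩ := hF.exists_sum w
  refine ⟨c, x, ?_, ?_⟩
  · rintro rfl
    obtain ⟨y, hy⟩ := hx 1
    apply hv0
    have h := congrArg π hy
    rw [map_zero, map_add, pow_one, π_smul, PowerSeries.constantCoeff_X, zero_smul, add_zero,
      Finset.sum_range_one, pow_zero, one_smul] at h
    rw [← πσ v]
    exact h.symm
  · have hD : D x = 0 := by
      refine hF.eq_zero_of_forall_X_pow fun n => ?_
      obtain ⟨y, hy⟩ := hx (n + 1)
      rw [hy, D_add, hr, D_X, ← smul_add, pow_succ, mul_smul]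
      exact ⟨_, rfl⟩
    rw [ht, sub_eq_zero.mp hD, smul_smul, mul_comm]

/-- The operator `S ↦ b².S' + c b.S` on `ℂ[[b]]`: the module of rank one whose generator `e`
satisfies `a e = c b e`. -/
@[reducible]
noncomputable def rankOne (c : ℂ) : ABAction ℂ⟦X⟧ where
  a :=
    { toFun := fun S => PowerSeries.X ^ 2 * PowerSeries.derivative ℂ S +
        PowerSeries.C c * PowerSeries.X * S
      map_zero' := by simp
      map_add' := by intro x y; simp only [map_add]; ring }
  a_smul := by
    intro S x
    simp only [AddMonoidHom.coe_mk, ZeroHom.coe_mk, smul_eq_mul, Derivation.leibniz]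
    ring

theorem isSemisimple_rankOne (c : ℂ) :
    @IsSemisimple ℂ⟦X⟧ _ _ (rankOne c) := by
  let _ := rankOne c
  have hf : IsABModule ℂ⟦X⟧ := ⟨inferInstance, inferInstance⟩
  refine IsSemisimple.of_isRegular_of_finrank_eq_one ⟨hf, ℂ⟦X⟧, inferInstance, inferInstance,
    inferInstance, hf, fun S => ⟨PowerSeries.X * PowerSeries.derivative ℂ S +
      PowerSeries.C c * S, ?_⟩, Hom.id _, fun _ _ h => h⟩ (finrank_self _)
  change PowerSeries.X ^ 2 * PowerSeries.derivative ℂ S + PowerSeries.C c * PowerSeries.X * S = _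
  rw [smul_eq_mul]
  ring

/-- The semi-simple part of a nonzero regular module is nonzero. -/
theorem IsRegular.ssPart_ne_bot [Nontrivial F] (hF : IsRegular F) :
    (ssPart F).toSubmodule ≠ ⊥ := by
  obtain ⟨G, N, hG, hN⟩ := hF.exists_simplePole
  obtain ⟨y, hy⟩ := exists_ne (0 : F)
  have : Nontrivial G.toSubmodule := by
    refine nontrivial_of_ne ⟨_, hN y⟩ 0 fun h => hy ?_
    refine hF.1.X_pow_cancel (n := N) ?_
    rw [smul_zero]
    exact congrArg Subtype.val h
  obtain ⟨c, ⟨x, hxG⟩, hx0, hx⟩ := hG.exists_eigenvector (hF.1.sub G)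
  replace hx : a x = (PowerSeries.C c * PowerSeries.X : ℂ⟦X⟧) • x := congrArg Subtype.val hx
  let _ := rankOne c
  let f : Hom ℂ⟦X⟧ F :=
    { toLinearMap := LinearMap.toSpanSingleton ℂ⟦X⟧ F x
      map_a := fun S => by
        rw [LinearMap.toSpanSingleton_apply, LinearMap.toSpanSingleton_apply, a_smul, hx,
          smul_smul, ← add_smul]
        congr 1
        change PowerSeries.X ^ 2 * PowerSeries.derivative ℂ S +
          PowerSeries.C c * PowerSeries.X * S = _
        ring }
  have hss : IsSemisimple f.range.toSubmodule :=
    (hF.1.sub _).isSemisimple_of_cofinal_hom (isSemisimple_rankOne c) f.rangeRestrict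
      fun ⟨y, S, hS⟩ => ⟨0, S, Subtype.ext (by rw [pow_zero, one_smul]; exact hS)⟩
  have hxmem : x ∈ f.range.toSubmodule := ⟨1, one_smul _ _⟩
  intro h
  have := le_ssPart hss hxmem
  rw [h, Submodule.mem_bot] at this
  exact hx0 (Subtype.ext this)

end

/-! ### Finiteness of the depth and comparison with the dual. -/

section

variable {E : Type*} [AddCommGroup E] [Module ℂ⟦X⟧ E] [ABAction E]

theorem IsRegular.exists_ssFiltration_eq_top (hE : IsRegular E) :
    ∃ j : ℕ, (ssFiltration E j).toSubmodule = ⊤ := by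
  have := hE.1.isNoetherian
  obtain ⟨n, hn⟩ := monotone_stabilizes_iff_noetherian.mpr this
    ⟨fun j => (ssFiltration E j).toSubmodule, monotone_nat_of_le_succ ssFiltration_le_succ⟩
  refine ⟨n, by_contra fun htop => ?_⟩
  -- Where the chain is stationary the quotient has zero semi-simple part, which is impossible for a
  -- nonzero regular module.
  have : Nontrivial (E ⧸ (ssFiltration E n).toSubmodule) :=
    Submodule.Quotient.nontrivial_iff.mpr htop
  refine (hE.quotient _ (hE.1.mem_ssFiltration_of_X_smul n)).ssPart_ne_bot ?_
  rw [eq_bot_iff]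
  intro x hx
  obtain ⟨x, rfl⟩ := Submodule.Quotient.mk_surjective _ x
  rw [← mem_ssFiltration_succ] at hx
  have h : (ssFiltration E n).toSubmodule = (ssFiltration E (n + 1)).toSubmodule :=
    hn (n + 1) n.le_succ
  rw [← h] at hx
  exact (Submodule.mem_bot _).mpr ((Submodule.Quotient.mk_eq_zero _).mpr hx)

/-- The linear forms on `P` induced by the linear forms on `E` which vanish on `Q`, for `P` the
pull-back of a sub-module of `E / Q`. -/
theorem exists_hom_dual_quotient {E' : Type*} [AddCommGroup E'] [Module ℂ⟦X⟧ E'] [ABAction E']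
    (f : Hom E' (Dual ℂ⟦X⟧ E)) (Q : ABSubmodule E) (G : ABSubmodule E')
    (hG : ∀ y ∈ G.toSubmodule, ∀ x ∈ Q.toSubmodule, f.toLinearMap y x = 0) :
    ∃ h : Hom G.toSubmodule (Dual ℂ⟦X⟧ (E ⧸ Q.toSubmodule)),
      ∀ y x, h.toLinearMap y (Submodule.Quotient.mk x) = f.toLinearMap y x := by
  refine ⟨⟨⟨⟨fun y => Q.toSubmodule.liftQ (f.toLinearMap y) (hG y y.2), ?_⟩, ?_⟩, ?_⟩,
    fun y x => rfl⟩
  · intro y z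
    refine Submodule.linearMap_qext _ (LinearMap.ext fun x => ?_)
    change f.toLinearMap (y + z) x = f.toLinearMap y x + f.toLinearMap z x
    rw [map_add, LinearMap.add_apply]
  · intro S y
    refine Submodule.linearMap_qext _ (LinearMap.ext fun x => ?_)
    change f.toLinearMap (S • y) x = S • f.toLinearMap y x
    rw [map_smul, LinearMap.smul_apply]
  · intro y
    refine Submodule.linearMap_qext _ (LinearMap.ext fun x => ?_)
    change f.toLinearMap (a (y : E')) x = a (f.toLinearMap (y : E')) x
    rw [f.map_a]

/-- The annihilator of `S_m(E)` in `E'` lies in `S_{n-m}(E')`. Allowing any `E'` embedded in the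
dual covers both the dual itself and a module inside its bidual. -/
theorem IsABModule.ssFiltration_eq_top_of_dual (hE : IsABModule E)
    {E' : Type*} [AddCommGroup E'] [Module ℂ⟦X⟧ E'] [ABAction E'] (hE' : IsABModule E')
    (f : Hom E' (Dual ℂ⟦X⟧ E)) (hf : Function.Injective f.toLinearMap) {n : ℕ}
    (hn : (ssFiltration E n).toSubmodule = ⊤) : (ssFiltration E' n).toSubmodule = ⊤ := by
  have key : ∀ j m, j + m = n → ∀ y : E',
      (∀ x ∈ (ssFiltration E m).toSubmodule, f.toLinearMap y x = 0) →
      y ∈ (ssFiltration E' j).toSubmodule := by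
    intro j
    induction j with
    | zero =>
      intro m hm y hy
      rw [zero_add] at hm
      subst hm
      have h0 : y = 0 := hf (by
        rw [map_zero]
        exact LinearMap.ext fun x => hy x (hn ▸ Submodule.mem_top))
      rw [h0]
      exact zero_mem _
    | succ j ih =>
      intro m hm y hy
      obtain ⟨G, hG⟩ : ∃ G : ABSubmodule E', ∀ y, y ∈ G.toSubmodule ↔
          ∀ x ∈ (ssFiltration E m).toSubmodule, f.toLinearMap y x = 0 :=
        ⟨{ carrier := {y | ∀ x ∈ (ssFiltration E m).toSubmodule, f.toLinearMap y x = 0}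
           zero_mem' := fun x _ => by simp
           add_mem' := fun {y z} hy hz x hx => by
             rw [map_add, LinearMap.add_apply, hy x hx, hz x hx, add_zero]
           smul_mem' := fun S y hy x hx => by
             rw [map_smul, LinearMap.smul_apply, hy x hx, smul_zero]
           a_mem := fun y hy x hx => by
             rw [f.map_a, dual_a_apply, hy x hx, hy _ ((ssFiltration E m).a_mem x hx), map_zero,
               mul_zero, sub_zero] }, fun _ => Iff.rfl⟩
      obtain ⟨h, hh⟩ := exists_hom_dual_quotient f (ssFiltration E m) G
        fun y => (hG y).mp
      -- `p` restricts forms to `S_{m+1}(E)/S_m(E)`. Its kernel annihilates `S_{m+1}(E)`, so by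
      -- induction `q` kills it and factors through the image of `p`, a sub-module of a semi-simple
      -- dual.
      let p := (ssPart (E ⧸ (ssFiltration E m).toSubmodule)).subtypeHom.dual.comp h
      let q := (ssFiltration E' j).mkQHom.comp G.subtypeHom
      have hss := (hE.quotient_ssFiltration m).isSemisimple_ssPart.dual
      have hE'q := hE'.quotient_ssFiltration j
      obtain ⟨k, hk⟩ := exists_hom_range p q fun z hz => by
        refine (Submodule.Quotient.mk_eq_zero _).mpr (ih (m + 1) (by omega) z fun x hx => ?_)
        rw [← hh]
        exact LinearMap.congr_fun hz ⟨_, mem_ssFiltration_succ.mp hx⟩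
      have hp : IsSemisimple p.range.toSubmodule :=
        hss.of_injective p.range.subtypeHom (Submodule.injective_subtype _)
      have hk' : IsSemisimple k.range.toSubmodule :=
        (hE'q.sub _).isSemisimple_of_cofinal_hom hp k.rangeRestrict fun ⟨y, z, hz⟩ =>
          ⟨0, z, Subtype.ext (by rw [pow_zero, one_smul]; exact hz)⟩
      rw [mem_ssFiltration_succ]
      exact le_ssPart hk' ⟨_, hk ⟨y, (hG y).mpr hy⟩⟩
  rw [eq_top_iff]
  intro y _
  refine key n 0 (add_zero n) y fun x hx => ?_
  have hx0 : x = 0 := (Submodule.mem_bot ℂ⟦X⟧).mp hx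
  rw [hx0, map_zero]

end

end ABAction

theorem corollary2p2p4 {E : Type*} [AddCommGroup E] [Module ℂ⟦X⟧ E] [ABAction E]
    (hE : ABAction.IsRegular E) :
    ABAction.IsRegular (Module.Dual ℂ⟦X⟧ E) ∧
    (∃ j : ℕ, (ABAction.ssFiltration E j).toSubmodule = ⊤) ∧
    (∃ j : ℕ, (ABAction.ssFiltration (Module.Dual ℂ⟦X⟧ E) j).toSubmodule = ⊤) ∧
    ABAction.ssDepth (Module.Dual ℂ⟦X⟧ E) = ABAction.ssDepth E := by
  refine ⟨hE.dual, hE.exists_ssFiltration_eq_top, hE.dual.exists_ssFiltration_eq_top, ?_⟩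
  unfold ABAction.ssDepth
  -- The sets of admissible `d` are equal, hence so are their infima.
  congr 1
  ext d
  exact ⟨hE.dual.1.ssFiltration_eq_top_of_dual hE.1 (ABAction.evalHom E)
      (ABAction.evalHom_injective hE.1),
    hE.1.ssFiltration_eq_top_of_dual hE.dual.1 (ABAction.Hom.id _) fun _ _ h => h⟩
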